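/- Let $G$ be a connected (real, finite-dimensional) Lie group that is nilpotent, and let $\phi : G \to G$ be a surjective endomorphism of $G$, that is, a surjective smooth group homomorphism. Then $\phi$ is a proper map, i.e. the preimage under $\phi$ of every compact subset of $G$ is compact. -/

import Mathlib

open scoped Manifold ContDiff

/-!
Finite subsets of a nilpotent group have polynomial growth. Hence, if `V` is a compact neighbourhood
of `1` whose powers exhaust the group, the `V`-separated subsets of `V ^ n` have at most
`(n + 1) ^ d` elements, for a fixed `d`. Suppose that `φ.ker` is not compact; then it contains
`V`-separated finite sets `T` as large as we please. A separated subset of `V ^ n` thins out, by a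
bounded factor, to a subset which is separated by `φ(V)`; as `V ⊆ φ(V ^ m)` for some `m`, this
subset lifts through `φ` into `V ^ (m * n)`, and multiplying the lift by `T` yields a separated
subset of `V ^ ((m + 1) * n)` which is larger than the given one by any prescribed factor `N`.
Iterating this with `N > (m + 1) ^ d` contradicts the polynomial bound. So `φ.ker` is compact, and
a continuous open surjective homomorphism with compact kernel is proper.
-/

open Set Topology
open scoped Pointwise commutatorElement

section PolynomialGrowth

variable {G : Type*} [Group G]

lemma iterate_commutator_mem_lowerCentralSeries (a : G) {h : G} {i : ℕ}
    (hh : h ∈ (⊤ : Subgroup G).lowerCentralSeries i) (j : ℕ) :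
    (⁅a, ·⁆)^[j] h ∈ (⊤ : Subgroup G).lowerCentralSeries (i + j) := by
  induction j with
  | zero => exact hh
  | succ j ih =>
    rw [Function.iterate_succ_apply', ← add_assoc, Subgroup.lowerCentralSeries_succ,
      Subgroup.commutator_comm]
    exact Subgroup.commutator_mem_commutator (Subgroup.mem_top a) ih

lemma iterate_commutator_eq_one {c : ℕ} (hc : (⊤ : Subgroup G).lowerCentralSeries c = ⊥)
    (a h : G) {j : ℕ} (hj : c ≤ j) : (⁅a, ·⁆)^[j] h = 1 := by
  have hmem := iterate_commutator_mem_lowerCentralSeries a (i := 0) (Subgroup.mem_top h) j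
  rw [zero_add] at hmem
  rw [← Subgroup.mem_bot, ← hc]
  exact Subgroup.lowerCentralSeries_antitone _ hj hmem

lemma conj_pow_mem_pow {a : G} {H : Set G} (hone : 1 ∈ H) (hH : ∀ h ∈ H, ⁅a, h⁆ ∈ H) {m : ℕ}
    {h : G} (hh : h ∈ H) (hm : (⁅a, ·⁆)^[m] h = 1) (t : ℕ) :
    MulAut.conj (a ^ t) h ∈ H ^ (t + 1) ^ m := by
  induction m generalizing h t with
  | zero => simpa [show h = 1 from hm] using hone
  | succ m ihm =>
    induction t with
    | zero => simpa using hh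
    | succ t iht =>
      have hconj : MulAut.conj (a ^ (t + 1)) h =
          MulAut.conj (a ^ t) ⁅a, h⁆ * MulAut.conj (a ^ t) h := by
        rw [← map_mul, pow_succ, map_mul, MulAut.mul_apply]
        simp [commutatorElement_def]
      have hexp : (t + 1) ^ m + (t + 1) ^ (m + 1) ≤ (t + 1 + 1) ^ (m + 1) :=
        calc (t + 1) ^ m + (t + 1) ^ (m + 1) = (t + 1 + 1) * (t + 1) ^ m := by ring
          _ ≤ (t + 1 + 1) * (t + 1 + 1) ^ m := by gcongr; omega
          _ = (t + 1 + 1) ^ (m + 1) := by ring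
      have hmul := mul_mem_mul (ihm (hH h hh) hm t) iht
      rw [← hconj, ← pow_add] at hmul
      exact pow_subset_pow_right hone hexp hmul

lemma exists_finset_commutator_mem {c : ℕ} (hc : (⊤ : Subgroup G).lowerCentralSeries c = ⊥)
    (a : G) (S : Finset G) :
    ∃ H : Finset G, S ⊆ H ∧ 1 ∈ H ∧ (∀ h ∈ H, ⁅a, h⁆ ∈ H) ∧
      ∀ h ∈ H, h = 1 ∨ ∃ s ∈ S, ∃ j : ℕ, (⁅a, ·⁆)^[j] s = h := by
  classical
  let H : Finset G := insert 1 ((Finset.range c).biUnion fun j => S.image (⁅a, ·⁆)^[j])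
  have hiter {s : G} (hs : s ∈ S) (j : ℕ) : (⁅a, ·⁆)^[j] s ∈ H := by
    rcases lt_or_ge j c with hj | hj
    · exact Finset.mem_insert_of_mem (Finset.mem_biUnion.2
        ⟨j, Finset.mem_range.2 hj, Finset.mem_image_of_mem _ hs⟩)
    · rw [iterate_commutator_eq_one hc a s hj]
      exact Finset.mem_insert_self ..
  have horbit : ∀ h ∈ H, h = 1 ∨ ∃ s ∈ S, ∃ j : ℕ, (⁅a, ·⁆)^[j] s = h := fun h hh => by
    refine (Finset.mem_insert.1 hh).imp_right fun hh => ?_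
    obtain ⟨j, -, hh⟩ := Finset.mem_biUnion.1 hh
    obtain ⟨s, hs, rfl⟩ := Finset.mem_image.1 hh
    exact ⟨s, hs, j, rfl⟩
  refine ⟨H, fun s hs => hiter hs 0, Finset.mem_insert_self .., fun h hh => ?_, horbit⟩
  rcases horbit h hh with rfl | ⟨s, hs, j, rfl⟩
  · simp [H]
  · rw [← Function.iterate_succ_apply' (⁅a, ·⁆)]
    exact hiter hs (j + 1)

variable [DecidableEq G]

/-- Polynomial growth of the powers of a finite set. Bounding by `(n + 1) ^ d` instead of
`C * n ^ d` loses nothing, as `F ^ 0` is a singleton and `C ≤ 2 ^ k` for some `k`. -/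
def HasPolynomialGrowth (F : Finset G) : Prop :=
  ∃ d : ℕ, ∀ n : ℕ, (F ^ n).card ≤ (n + 1) ^ d

lemma HasPolynomialGrowth.mono {F F' : Finset G} (hF' : HasPolynomialGrowth F') (h : F ⊆ F') :
    HasPolynomialGrowth F := by
  obtain ⟨d, hd⟩ := hF'
  exact ⟨d, fun n => (Finset.card_le_card (Finset.pow_subset_pow_left h)).trans (hd n)⟩

lemma hasPolynomialGrowth_of_subset_one {F : Finset G} (hF : F ⊆ 1) : HasPolynomialGrowth F :=
  HasPolynomialGrowth.mono ⟨0, fun n => by simp⟩ hF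

-- The letters `a` of a word are collected on the right; each letter of `H` is conjugated by at
-- most `n` of them, and these conjugates are short words in `H` by `conj_pow_mem_pow`.
lemma insert_pow_subset {a : G} {H : Finset G} (hone : 1 ∈ H) (hH : ∀ h ∈ H, ⁅a, h⁆ ∈ H) {m : ℕ}
    (hm : ∀ h ∈ H, (⁅a, ·⁆)^[m] h = 1) (n : ℕ) :
    insert a H ^ n ⊆ H ^ (n * (n + 1) ^ m) * (Finset.range (n + 1)).image (a ^ ·) := by
  induction n with
  | zero => simp [← Finset.singleton_one]
  | succ n ih =>
    have hexp : n * (n + 1) ^ m + (n + 1) ^ m ≤ (n + 1) * (n + 1 + 1) ^ m :=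
      calc n * (n + 1) ^ m + (n + 1) ^ m = (n + 1) * (n + 1) ^ m := by ring
        _ ≤ (n + 1) * (n + 1 + 1) ^ m := by gcongr; omega
    rw [pow_succ]
    intro x hx
    obtain ⟨y, hy, b, hb, rfl⟩ := Finset.mem_mul.1 hx
    obtain ⟨w, hw, _, has, rfl⟩ := Finset.mem_mul.1 (ih hy)
    obtain ⟨s, hs, rfl⟩ := Finset.mem_image.1 has
    have hsn : s < n + 1 := Finset.mem_range.1 hs
    rcases Finset.mem_insert.1 hb with rfl | hb
    · rw [mul_assoc, ← pow_succ]
      exact Finset.mul_mem_mul (Finset.pow_subset_pow_right hone (by omega) hw)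
        (Finset.mem_image_of_mem _ (Finset.mem_range.2 (by omega)))
    · have hcollect : w * a ^ s * b = w * MulAut.conj (a ^ s) b * a ^ s := by
        rw [MulAut.conj_apply]; group
      have hconj : MulAut.conj (a ^ s) b ∈ H ^ (n + 1) ^ m := by
        have := conj_pow_mem_pow (H := (H : Set G)) hone hH hb (hm b hb) s
        rw [← Finset.coe_pow, Finset.mem_coe] at this
        exact Finset.pow_subset_pow_right hone (Nat.pow_le_pow_left hsn m) this
      have hword := Finset.mul_mem_mul hw hconj
      rw [← pow_add] at hword
      rw [hcollect]
      exact Finset.mul_mem_mul (Finset.pow_subset_pow_right hone hexp hword)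
        (Finset.mem_image_of_mem _ (Finset.mem_range.2 (by omega)))

lemma HasPolynomialGrowth.insert {a : G} {H : Finset G} (hgrowth : HasPolynomialGrowth H)
    (hone : 1 ∈ H) (hH : ∀ h ∈ H, ⁅a, h⁆ ∈ H) {m : ℕ} (hm : ∀ h ∈ H, (⁅a, ·⁆)^[m] h = 1) :
    HasPolynomialGrowth (insert a H) := by
  obtain ⟨d, hd⟩ := hgrowth
  have hexp (n : ℕ) : n * (n + 1) ^ m + 1 ≤ (n + 1) ^ (m + 1) :=
    calc n * (n + 1) ^ m + 1 ≤ n * (n + 1) ^ m + (n + 1) ^ m := by gcongr; exact Nat.one_le_pow' _ _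
      _ = (n + 1) ^ (m + 1) := by ring
  refine ⟨(m + 1) * d + 1, fun n => ?_⟩
  calc (Insert.insert a H ^ n).card
      ≤ (H ^ (n * (n + 1) ^ m) * (Finset.range (n + 1)).image (a ^ ·)).card :=
        Finset.card_le_card (insert_pow_subset hone hH hm n)
    _ ≤ (H ^ (n * (n + 1) ^ m)).card * ((Finset.range (n + 1)).image (a ^ ·)).card :=
        Finset.card_mul_le
    _ ≤ (n * (n + 1) ^ m + 1) ^ d * (n + 1) := by
        gcongr
        · exact hd _
        · exact Finset.card_image_le.trans (Finset.card_range _).le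
    _ ≤ ((n + 1) ^ (m + 1)) ^ d * (n + 1) := by gcongr; exact hexp n
    _ = (n + 1) ^ ((m + 1) * d + 1) := by rw [← pow_mul, ← pow_succ]

lemma hasPolynomialGrowth_union_of_lowerCentralSeries {c i : ℕ}
    (hc : (⊤ : Subgroup G).lowerCentralSeries c = ⊥)
    (hi : ∀ F : Finset G, (F : Set G) ⊆ (⊤ : Subgroup G).lowerCentralSeries (i + 1) →
      HasPolynomialGrowth F)
    {S F : Finset G} (hS : (S : Set G) ⊆ (⊤ : Subgroup G).lowerCentralSeries i)
    (hF : (F : Set G) ⊆ (⊤ : Subgroup G).lowerCentralSeries (i + 1)) :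
    HasPolynomialGrowth (S ∪ F) := by
  induction S using Finset.induction_on generalizing F with
  | empty => simpa using hi F hF
  | insert a S _ ih =>
    rw [Finset.coe_insert, insert_subset_iff] at hS
    obtain ⟨H, hSH, hone, hH, horbit⟩ := exists_finset_commutator_mem hc a (S ∪ F)
    classical
    let F' : Finset G := {h ∈ H | h ∈ (⊤ : Subgroup G).lowerCentralSeries (i + 1)}
    have hsub : H ⊆ S ∪ F' := fun h hh => by
      rw [Finset.mem_union, Finset.mem_filter, or_iff_not_imp_left]
      refine fun hhS => ⟨hh, ?_⟩
      rcases horbit h hh with rfl | ⟨s, hs, _ | j, rfl⟩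
      · exact one_mem _
      · exact hF ((Finset.mem_union.1 hs).resolve_left hhS)
      · have hs' : s ∈ (⊤ : Subgroup G).lowerCentralSeries i :=
          (Finset.mem_union.1 hs).elim (fun hs => hS.2 hs)
            fun hs => Subgroup.lowerCentralSeries_antitone _ i.le_succ (hF hs)
        exact Subgroup.lowerCentralSeries_antitone _ (by omega)
          (iterate_commutator_mem_lowerCentralSeries a hs' (j + 1))
    have hgrowth : HasPolynomialGrowth H :=
      (ih hS.2 fun h hh => (Finset.mem_filter.1 hh).2).mono hsub
    refine (hgrowth.insert hone hH fun h _ => iterate_commutator_eq_one hc a h le_rfl).mono ?_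
    rw [Finset.insert_union]
    exact Finset.insert_subset_insert a hSH

theorem hasPolynomialGrowth_of_isNilpotent [Group.IsNilpotent G] (F : Finset G) :
    HasPolynomialGrowth F := by
  obtain ⟨c, hc⟩ := Subgroup.nilpotent_iff_lowerCentralSeries.1 ‹Group.IsNilpotent G›
  suffices h : ∀ i ≤ c, ∀ F : Finset G, (F : Set G) ⊆ (⊤ : Subgroup G).lowerCentralSeries i →
      HasPolynomialGrowth F from h 0 c.zero_le F fun x _ => Subgroup.mem_top x
  intro i hi
  induction hi using Nat.decreasingInduction with
  | self =>
    intro F hF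
    rw [hc, Subgroup.coe_bot] at hF
    exact hasPolynomialGrowth_of_subset_one (by exact_mod_cast hF)
  | of_succ i _ ih =>
    intro F hF
    simpa using hasPolynomialGrowth_union_of_lowerCentralSeries hc ih hF (F := ∅) (by simp)

end PolynomialGrowth

section Separation

variable {G H : Type*} [Group G] [Group H]

/-- `S` is separated by `V` if the translates `x * V⁻¹`, for `x ∈ S`, are pairwise disjoint. This
encoding makes every set covered by `n` translates of `V` contain at most `n` points of `S`. -/
def IsSeparatedBy (V S : Set G) : Prop :=
  S.Pairwise fun x y => x⁻¹ * y ∉ V⁻¹ * V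

lemma IsSeparatedBy.eq {V S : Set G} (hS : IsSeparatedBy V S) {x y : G} (hx : x ∈ S) (hy : y ∈ S)
    (h : x⁻¹ * y ∈ V⁻¹ * V) : x = y :=
  Set.Pairwise.eq hS hx hy (not_not_intro h)

lemma IsSeparatedBy.card_le_card {V : Set G} {S F : Finset G} (hS : IsSeparatedBy V (S : Set G))
    (hSF : (S : Set G) ⊆ F * V) : S.card ≤ F.card := by
  refine Finset.card_le_card_of_forall_subsingleton (fun x g => g⁻¹ * x ∈ V) (fun x hx => ?_) ?_
  · obtain ⟨g, hg, v, hv, rfl⟩ := hSF hx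
    exact ⟨g, hg, by simpa using hv⟩
  · rintro g - x ⟨hx, hxg⟩ y ⟨hy, hyg⟩
    exact hS.eq hx hy ⟨(g⁻¹ * x)⁻¹, inv_mem_inv.2 hxg, g⁻¹ * y, hyg, by group⟩

lemma exists_isSeparatedBy_subset_mul {V : Set G} (hV : V.Nonempty) (A : Set G) :
    ∃ S ⊆ A, IsSeparatedBy V S ∧ A ⊆ S * (V⁻¹ * V) := by
  obtain ⟨S, hS⟩ := zorn_subset {S | S ⊆ A ∧ IsSeparatedBy V S} fun c hc hchain =>
    ⟨⋃₀ c, ⟨sUnion_subset fun s hs => (hc hs).1,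
      (pairwise_sUnion hchain.directedOn).2 fun s hs => (hc hs).2⟩,
      fun s hs => subset_sUnion_of_mem hs⟩
  refine ⟨S, hS.prop.1, hS.prop.2, fun x hx => ?_⟩
  by_contra hxS
  have hfar : ∀ s ∈ S, s⁻¹ * x ∉ V⁻¹ * V := fun s hs h =>
    hxS ⟨s, hs, s⁻¹ * x, h, mul_inv_cancel_left s x⟩
  have hfar' : ∀ s ∈ S, x⁻¹ * s ∉ V⁻¹ * V := fun s hs h =>
    hfar s hs (by simpa using inv_mem_inv.2 h)
  have hmem : x ∈ S := hS.mem_of_prop_insert ⟨insert_subset hx hS.prop.1,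
    pairwise_insert.2 ⟨hS.prop.2, fun s hs _ => ⟨hfar' s hs, hfar s hs⟩⟩⟩
  obtain ⟨v, hv⟩ := hV
  exact hfar x hmem ⟨v⁻¹, inv_mem_inv.2 hv, v, hv, by simp⟩

lemma exists_subset_isSeparatedBy_card_le_mul {V W : Set G} {S B : Finset G}
    (hS : IsSeparatedBy V (S : Set G)) (hW : W.Nonempty) (hB : W⁻¹ * W ⊆ B * V) :
    ∃ S' ⊆ S, IsSeparatedBy W (S' : Set G) ∧ S.card ≤ S'.card * B.card := by
  classical
  obtain ⟨S', hS'S, hS', hcover⟩ := exists_isSeparatedBy_subset_mul hW (S : Set G)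
  lift S' to Finset G using S.finite_toSet.subset hS'S
  refine ⟨S', by exact_mod_cast hS'S, hS', (hS.card_le_card ?_).trans Finset.card_mul_le⟩
  rw [Finset.coe_mul, mul_assoc]
  exact hcover.trans (mul_subset_mul_left hB)

lemma exists_isSeparatedBy_card_eq_mul {φ : G →* H} {V A C : Set G} (hV : V.Nonempty)
    {S : Finset H} (hSA : (S : Set H) ⊆ φ '' A) (hS : IsSeparatedBy (φ '' V) (S : Set H))
    {T : Finset G} (hTC : (T : Set G) ⊆ C) (hTker : (T : Set G) ⊆ φ.ker)
    (hT : IsSeparatedBy V (T : Set G)) :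
    ∃ R : Finset G, (R : Set G) ⊆ A * C ∧ IsSeparatedBy V (R : Set G) ∧
      R.card = S.card * T.card := by
  classical
  obtain ⟨L, hLA, hLinj, rfl⟩ := Finset.exists_subset_injOn_image_eq_of_surjOn A S hSA
  have hprod : ∀ x ∈ L, ∀ t ∈ T, ∀ y ∈ L, ∀ u ∈ T, (x * t)⁻¹ * (y * u) ∈ V⁻¹ * V →
      x = y ∧ t = u := by
    intro x hx t ht y hy u hu h
    have hφ : (φ x)⁻¹ * φ y ∈ (φ '' V)⁻¹ * φ '' V := by
      have := mem_image_of_mem φ h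
      rw [image_mul, image_inv] at this
      simpa [MonoidHom.mem_ker.1 (hTker ht), MonoidHom.mem_ker.1 (hTker hu)] using this
    obtain rfl : x = y := hLinj hx hy
      (hS.eq (Finset.mem_image_of_mem φ hx) (Finset.mem_image_of_mem φ hy) hφ)
    exact ⟨rfl, hT.eq ht hu (by simpa [mul_assoc] using h)⟩
  refine ⟨L * T, ?_, ?_, ?_⟩
  · rw [Finset.coe_mul]
    exact mul_subset_mul hLA hTC
  · intro p hp q hq hpq h
    obtain ⟨x, hx, t, ht, rfl⟩ := Finset.mem_mul.1 hp
    obtain ⟨y, hy, u, hu, rfl⟩ := Finset.mem_mul.1 hq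
    obtain ⟨rfl, rfl⟩ := hprod x hx t ht y hy u hu h
    exact hpq rfl
  · rw [Finset.card_image_of_injOn hLinj]
    refine Finset.card_mul_iff.2 ?_
    rintro ⟨x, t⟩ hxt ⟨y, u⟩ hyu (h : x * t = y * u)
    obtain ⟨v, hv⟩ := hV
    obtain ⟨rfl, rfl⟩ := hprod x hxt.1 t hxt.2 y hyu.1 u hyu.2
      ⟨v⁻¹, inv_mem_inv.2 hv, v, hv, by simp [h]⟩
    rfl

end Separation

section Compactness

lemma iUnion_pow_eq_univ {G : Type*} [Group G] {V : Set G} (hV : V⁻¹ = V)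
    (hgen : Subgroup.closure V = ⊤) : ⋃ n : ℕ, V ^ n = univ := by
  refine eq_univ_of_forall fun x => mem_iUnion.2 ?_
  have hx : x ∈ Subgroup.closure V := hgen ▸ Subgroup.mem_top x
  induction hx using Subgroup.closure_induction with
  | mem x hx => exact ⟨1, by simpa using hx⟩
  | one => exact ⟨0, by simp⟩
  | mul x y _ _ hx hy =>
    obtain ⟨⟨m, hm⟩, n, hn⟩ := hx, hy
    exact ⟨m + n, pow_add V m n ▸ mul_mem_mul hm hn⟩
  | inv x _ hx =>
    obtain ⟨n, hn⟩ := hx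
    refine ⟨n, ?_⟩
    rw [← hV, inv_pow]
    exact inv_mem_inv.2 hn

lemma isCompact_pow {M : Type*} [Monoid M] [TopologicalSpace M] [ContinuousMul M] {V : Set M}
    (hV : IsCompact V) (n : ℕ) : IsCompact (V ^ n) := by
  induction n with
  | zero => simp
  | succ n ih => rw [pow_succ]; exact ih.mul hV

variable {G : Type*} [Group G] [TopologicalSpace G] [IsTopologicalGroup G]

lemma exists_subset_finset_mul {K V : Set G} (hK : IsCompact K) (hV : (interior V).Nonempty) :
    ∃ F : Finset G, K ⊆ F * V := by
  classical
  obtain ⟨t, ht⟩ := compact_covered_by_mul_left_translates hK hV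
  refine ⟨t⁻¹, fun x hx => ?_⟩
  obtain ⟨g, hg, hgx⟩ := mem_iUnion₂.1 (ht hx)
  exact ⟨g⁻¹, by simpa using hg, g * x, hgx, inv_mul_cancel_left g x⟩

lemma exists_isSeparatedBy_card_eq {A V : Set G} (hA : IsClosed A) (hAc : ¬ IsCompact A)
    (hV : IsCompact V) (hVne : V.Nonempty) (k : ℕ) :
    ∃ S : Finset G, (S : Set G) ⊆ A ∧ IsSeparatedBy V (S : Set G) ∧ S.card = k := by
  obtain ⟨S, hSA, hS, hcover⟩ := exists_isSeparatedBy_subset_mul hVne A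
  have hinf : S.Infinite := fun hfin =>
    hAc ((hfin.isCompact.mul (hV.inv.mul hV)).of_isClosed_subset hA hcover)
  obtain ⟨T, hTS, hT⟩ := hinf.exists_subset_card_eq k
  exact ⟨T, hTS.trans hSA, hS.mono hTS, hT⟩

lemma exists_subset_image_pow {X : Type*} [TopologicalSpace X] {V : Set G} (hV : V ∈ 𝓝 (1 : G))
    (hgen : ⋃ n : ℕ, V ^ n = univ) {f : G → X} (hf : IsOpenMap f) (hsurj : Function.Surjective f)
    {C : Set X} (hC : IsCompact C) : ∃ n : ℕ, C ⊆ f '' V ^ n := by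
  have hinterior (n : ℕ) : V ^ n ⊆ interior (V ^ (n + 1)) := fun x hx => by
    rw [pow_succ]
    exact subset_interior_mul_right ⟨x, hx, 1, mem_interior_iff_mem_nhds.2 hV, mul_one x⟩
  have hcover : C ⊆ ⋃ n : ℕ, f '' interior (V ^ n) := fun x _ => by
    obtain ⟨y, rfl⟩ := hsurj x
    obtain ⟨n, hn⟩ := mem_iUnion.1 (hgen.ge (mem_univ y))
    exact mem_iUnion.2 ⟨n + 1, y, hinterior n hn, rfl⟩
  have hmono : Monotone fun n : ℕ => f '' interior (V ^ n) := fun m n hmn =>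
    image_mono (interior_mono (pow_subset_pow_right (mem_of_mem_nhds hV) hmn))
  obtain ⟨n, hn⟩ := hC.elim_directed_cover _ (fun n => hf _ isOpen_interior) hcover
    hmono.directed_le
  exact ⟨n, hn.trans (image_mono interior_subset)⟩

lemma exists_isCompact_mem_nhds_iUnion_pow_eq_univ [LocallyCompactSpace G] {K : Set G}
    (hK : IsCompact K) (hgen : Subgroup.closure K = ⊤) :
    ∃ V : Set G, IsCompact V ∧ V ∈ 𝓝 1 ∧ ⋃ n : ℕ, V ^ n = univ := by
  obtain ⟨C, hC, hC1⟩ := exists_compact_mem_nhds (1 : G)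
  have hL : IsCompact (K ∪ C) := hK.union hC
  refine ⟨(K ∪ C) ∪ (K ∪ C)⁻¹, hL.union hL.inv, Filter.mem_of_superset hC1 ?_,
    iUnion_pow_eq_univ (by rw [union_inv, inv_inv, union_comm]) (top_unique ?_)⟩
  · exact subset_union_right.trans subset_union_left
  · rw [← hgen]
    exact Subgroup.closure_mono (subset_union_left.trans subset_union_left)

lemma exists_isCompact_closure_eq_top (G : Type*) [Group G] [TopologicalSpace G]
    [IsTopologicalGroup G] [LocallyCompactSpace G] [ConnectedSpace G] :
    ∃ K : Set G, IsCompact K ∧ Subgroup.closure K = ⊤ := by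
  obtain ⟨K, hK, hK1⟩ := exists_compact_mem_nhds (1 : G)
  have hopen : IsOpen (Subgroup.closure K : Set G) :=
    Subgroup.isOpen_of_mem_nhds _ (Filter.mem_of_superset hK1 Subgroup.subset_closure)
  have hclopen : IsClopen (Subgroup.closure K : Set G) :=
    ⟨Subgroup.isClosed_of_isOpen _ hopen, hopen⟩
  exact ⟨K, hK, SetLike.coe_injective (hclopen.eq_univ ⟨1, one_mem _⟩)⟩

end Compactness

section Growth

variable {G : Type*} [Group G] [TopologicalSpace G] [IsTopologicalGroup G]

lemma exists_card_le_of_isSeparatedBy [DecidableEq G]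
    (hgrowth : ∀ F : Finset G, HasPolynomialGrowth F) {V : Set G} (hV : IsCompact V)
    (hV1 : V ∈ 𝓝 (1 : G)) :
    ∃ d : ℕ, ∀ (n : ℕ) (S : Finset G), (S : Set G) ⊆ V ^ n → IsSeparatedBy V (S : Set G) →
      S.card ≤ (n + 1) ^ d := by
  obtain ⟨F, hF⟩ := exists_subset_finset_mul (isCompact_pow hV 2)
    ⟨1, mem_interior_iff_mem_nhds.2 hV1⟩
  obtain ⟨d, hd⟩ := hgrowth F
  refine ⟨d, fun n S hSV hS => (hS.card_le_card (F := F ^ n) ?_).trans (hd n)⟩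
  rw [Finset.coe_pow]
  calc (S : Set G) ⊆ V ^ n := hSV
    _ ⊆ V ^ (n + 1) := pow_subset_pow_right (mem_of_mem_nhds hV1) n.le_succ
    _ ⊆ (F : Set G) ^ n * V := pow_subset_pow_mul_of_sq_subset_mul hF n.succ_ne_zero

variable {φ : G →* G} {V : Set G} {m : ℕ}

lemma exists_isSeparatedBy_mul_card_le [T1Space G] (hφ : Continuous φ)
    (hker : ¬ IsCompact (φ.ker : Set G)) (hV : IsCompact V) (hV1 : V ∈ 𝓝 (1 : G))
    (hgen : ⋃ n : ℕ, V ^ n = univ) (hm : V ⊆ φ '' V ^ m) (N : ℕ) :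
    ∃ n₀ : ℕ, ∀ n ≥ n₀, ∀ S : Finset G, (S : Set G) ⊆ V ^ n → IsSeparatedBy V (S : Set G) →
      ∃ R : Finset G, (R : Set G) ⊆ V ^ ((m + 1) * n) ∧ IsSeparatedBy V (R : Set G) ∧
        N * S.card ≤ R.card := by
  have hone : (1 : G) ∈ V := mem_of_mem_nhds hV1
  have hφV : IsCompact (φ '' V) := hV.image hφ
  have hclosed : IsClosed (φ.ker : Set G) := isClosed_singleton.preimage hφ
  obtain ⟨B, hB⟩ := exists_subset_finset_mul (hφV.inv.mul hφV)
    ⟨1, mem_interior_iff_mem_nhds.2 hV1⟩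
  obtain ⟨T, hTker, hT, hTcard⟩ :=
    exists_isSeparatedBy_card_eq hclosed hker hV ⟨1, hone⟩ (N * B.card)
  obtain ⟨n₀, hTV⟩ := exists_subset_image_pow hV1 hgen IsOpenMap.id Function.surjective_id
    T.finite_toSet.isCompact
  rw [image_id] at hTV
  refine ⟨n₀, fun n hn S hSV hS => ?_⟩
  obtain ⟨S', hS'S, hS', hcard⟩ :=
    exists_subset_isSeparatedBy_card_le_mul hS (Nonempty.image φ ⟨1, hone⟩) hB
  have hlift : (S' : Set G) ⊆ φ '' V ^ (m * n) :=
    calc (S' : Set G) ⊆ V ^ n := (Finset.coe_subset.2 hS'S).trans hSV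
      _ ⊆ (φ '' V ^ m) ^ n := pow_subset_pow_left hm
      _ = φ '' V ^ (m * n) := by rw [pow_mul, image_pow φ (V ^ m)]
  obtain ⟨R, hRV, hR, hRcard⟩ := exists_isSeparatedBy_card_eq_mul ⟨1, hone⟩ hlift hS'
    (hTV.trans (pow_subset_pow_right hone hn)) hTker hT
  refine ⟨R, by rwa [← pow_add, ← add_one_mul] at hRV, hR, ?_⟩
  calc N * S.card ≤ N * (S'.card * B.card) := by gcongr
    _ = S'.card * (N * B.card) := by ring
    _ = R.card := by rw [hRcard, hTcard]

lemma exists_isSeparatedBy_pow_le_card [T1Space G] (hφ : Continuous φ)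
    (hker : ¬ IsCompact (φ.ker : Set G)) (hV : IsCompact V) (hV1 : V ∈ 𝓝 (1 : G))
    (hgen : ⋃ n : ℕ, V ^ n = univ) (hm : V ⊆ φ '' V ^ m) (N : ℕ) :
    ∃ n₀ : ℕ, ∀ j : ℕ, ∃ S : Finset G, (S : Set G) ⊆ V ^ ((m + 1) ^ j * n₀) ∧
      IsSeparatedBy V (S : Set G) ∧ N ^ j ≤ S.card := by
  obtain ⟨n₀, hstep⟩ := exists_isSeparatedBy_mul_card_le hφ hker hV hV1 hgen hm N
  refine ⟨n₀, fun j => ?_⟩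
  induction j with
  | zero =>
    refine ⟨{1}, ?_, ?_, by simp⟩
    · simpa using one_mem_pow (mem_of_mem_nhds hV1)
    · rw [Finset.coe_singleton]
      exact pairwise_singleton _ _
  | succ j ih =>
    obtain ⟨S, hSV, hS, hcard⟩ := ih
    obtain ⟨R, hRV, hR, hRcard⟩ :=
      hstep _ (Nat.le_mul_of_pos_left n₀ (Nat.pow_pos m.succ_pos)) S hSV hS
    refine ⟨R, by rwa [← mul_assoc, ← pow_succ'] at hRV, hR, ?_⟩
    calc N ^ (j + 1) = N * N ^ j := pow_succ' N j
      _ ≤ N * S.card := by gcongr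
      _ ≤ R.card := hRcard

theorem isCompact_ker_of_hasPolynomialGrowth [DecidableEq G] [T1Space G]
    (hgrowth : ∀ F : Finset G, HasPolynomialGrowth F) (hφ : Continuous φ) (hopen : IsOpenMap φ)
    (hsurj : Function.Surjective φ) (hV : IsCompact V) (hV1 : V ∈ 𝓝 (1 : G))
    (hgen : ⋃ n : ℕ, V ^ n = univ) : IsCompact (φ.ker : Set G) := by
  by_contra hker
  obtain ⟨m, hm⟩ := exists_subset_image_pow hV1 hgen hopen hsurj hV
  obtain ⟨d, hd⟩ := exists_card_le_of_isSeparatedBy hgrowth hV hV1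
  obtain ⟨n₀, hn₀⟩ :=
    exists_isSeparatedBy_pow_le_card hφ hker hV hV1 hgen hm (2 * (m + 1) ^ d)
  have hbound (j : ℕ) : 2 ^ j ≤ (n₀ + 1) ^ d := by
    obtain ⟨S, hSV, hS, hcard⟩ := hn₀ j
    refine Nat.le_of_mul_le_mul_right ?_ (Nat.pow_pos m.succ_pos : 0 < (m + 1) ^ (j * d))
    calc 2 ^ j * (m + 1) ^ (j * d) = (2 * (m + 1) ^ d) ^ j := by ring
      _ ≤ S.card := hcard
      _ ≤ ((m + 1) ^ j * n₀ + 1) ^ d := hd _ S hSV hS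
      _ ≤ ((m + 1) ^ j * (n₀ + 1)) ^ d := by
        rw [mul_add_one]
        gcongr
        exact Nat.one_le_pow' _ _
      _ = (n₀ + 1) ^ d * (m + 1) ^ (j * d) := by rw [mul_pow, ← pow_mul, mul_comm]
  exact (hbound _).not_gt Nat.lt_two_pow_self

end Growth

section Proper

theorem isProperMap_of_isCompact_ker {G H : Type*} [Group G] [TopologicalSpace G]
    [IsTopologicalGroup G] [Group H] [TopologicalSpace H] {φ : G →* H} (hφ : Continuous φ)
    (hopen : IsOpenMap φ) (hsurj : Function.Surjective φ) (hker : IsCompact (φ.ker : Set G)) :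
    IsProperMap φ := by
  have hfiber (x : G) : φ ⁻¹' {φ x} = x • (φ.ker : Set G) := by
    ext y
    simp [mem_smul_set_iff_inv_smul_mem, MonoidHom.mem_ker, inv_mul_eq_one,
      eq_comm (a := φ x)]
  have hsaturation (A : Set G) : φ ⁻¹' (φ '' A) = A * φ.ker := by
    ext y
    constructor
    · rintro ⟨x, hx, hxy⟩
      exact ⟨x, hx, x⁻¹ * y, by simp [MonoidHom.mem_ker, hxy], mul_inv_cancel_left x y⟩
    · rintro ⟨x, hx, k, hk, rfl⟩
      exact ⟨x, hx, by simp [MonoidHom.mem_ker.1 hk]⟩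
  refine isProperMap_iff_isClosedMap_and_compact_fibers.2 ⟨hφ, fun A hA => ?_, fun y => ?_⟩
  · rw [← (hopen.isQuotientMap hφ hsurj).isClosed_preimage, hsaturation]
    exact hA.mul_right_of_isCompact hker
  · obtain ⟨x, rfl⟩ := hsurj y
    rw [hfiber]
    exact hker.smul x

theorem mainTheorem11_general {G : Type*} [Group G] [TopologicalSpace G] [IsTopologicalGroup G]
    [T2Space G] [LocallyCompactSpace G] [Group.IsNilpotent G] {K : Set G} (hK : IsCompact K)
    (hgen : Subgroup.closure K = ⊤) {φ : G →* G} (hφ : Continuous φ)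
    (hsurj : Function.Surjective φ) : IsProperMap φ := by
  classical
  obtain ⟨V, hV, hV1, hVgen⟩ := exists_isCompact_mem_nhds_iUnion_pow_eq_univ hK hgen
  have : SigmaCompactSpace G := ⟨fun n => V ^ n, isCompact_pow hV, hVgen⟩
  have hopen : IsOpenMap φ := φ.isOpenMap_of_sigmaCompact hsurj hφ
  exact isProperMap_of_isCompact_ker hφ hopen hsurj
    (isCompact_ker_of_hasPolynomialGrowth hasPolynomialGrowth_of_isNilpotent hφ hopen hsurj
      hV hV1 hVgen)

end Proper

theorem mainTheorem11
    {E : Type*} [NormedAddCommGroup E] [NormedSpace ℝ E] [FiniteDimensional ℝ E]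
    {G : Type*} [Group G] [TopologicalSpace G] [T2Space G] [SecondCountableTopology G]
    [ChartedSpace E G] [LieGroup 𝓘(ℝ, E) ∞ G]
    [ConnectedSpace G] [Group.IsNilpotent G]
    (φ : ContMDiffMonoidMorphism 𝓘(ℝ, E) 𝓘(ℝ, E) ∞ G G)
    (hφ : Function.Surjective φ) :
    IsProperMap φ := by
  have : IsTopologicalGroup G := topologicalGroup_of_lieGroup 𝓘(ℝ, E) ∞
  have : LocallyCompactSpace G := Manifold.locallyCompact_of_finiteDimensional 𝓘(ℝ, E)
  obtain ⟨K, hK, hgen⟩ := exists_isCompact_closure_eq_top G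
  exact mainTheorem11_general hK hgen (φ := φ.toMonoidHom) φ.contMDiff_toFun.continuous hφ
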